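/- Throughout, rings are commutative. Let $B$ be an algebra over a ring $A$. An element $\theta\in B$ is a monogenerator of $B/A$ if $B=A[\theta]$, and $B/A$ is monogenic if it has a monogenerator. A twisted monogenerator of $B/A$ consists of 1. a Zariski open cover $\operatorname{Spec} A=\bigcup_i D(f_i)$ with $f_i\in A$, 2. for each $i$ a monogenerator $\theta_i\in B[f_i^{-1}]$ of $B[f_i^{-1}]$ over $A[f_i^{-1}]$, and 3. for all $i,j$ a unit $a_{ij}\in A[f_i^{-1},f_j^{-1}]^{*}$ such that $a_{ij}\theta_j=\theta_i$ in $B[f_i^{-1},f_j^{-1}]$ for all $i,j$, and $a_{ij}a_{jk}=a_{ik}$ in $A[f_i^{-1},f_j^{-1},f_k^{-1}]$ for all $i,j,k$. The extension $B/A$ is twisted monogenic if it has a twisted monogenerator. **Theorem.** Let $K$ be a number field with ring of integers $\mathbb Z_K$. Then $K$ has class number one if and only if, for every extension of number fields $L/K$ such that the extension of rings of integers $\mathbb Z_L/\mathbb Z_K$ is twisted monogenic, $\mathbb Z_L/\mathbb Z_K$ is monogenic. -/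

import Mathlib

open scoped NumberField TensorProduct

universe u v

section TwistedMonogenicity

variable (A : Type u) [CommRing A] (B : Type v) [CommRing B] [Algebra A B]

/-- `θ` is a monogenerator of the `A`-algebra `B`: `B = A[θ]`. -/
def IsMonogenerator {B : Type v} [CommRing B] [Algebra A B] (θ : B) : Prop :=
  Algebra.adjoin A {θ} = ⊤

/-- `B` is monogenic over `A`: `B = A[θ]` for some `θ ∈ B`. -/
def IsMonogenic : Prop :=
  ∃ θ : B, IsMonogenerator A θ

variable {A}

/-- The canonical `A`-algebra map `A[1/f] → A[1/g]` for `f ∣ g`, i.e. the restriction of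
functions from `D(f)` to `D(g) ⊆ D(f)`. -/
noncomputable def awayRes {f g : A} (h : f ∣ g) :
    Localization.Away f →ₐ[A] Localization.Away g :=
  IsLocalization.liftAlgHom (M := Submonoid.powers f)
    (f := Algebra.ofId A (Localization.Away g)) (by
      rintro ⟨_, n, rfl⟩
      rw [map_pow]
      exact (isUnit_of_dvd_unit (map_dvd (algebraMap A (Localization.Away g)) h)
        (IsLocalization.Away.algebraMap_isUnit g)).pow n)

/-- The localization `B[1/f]` of the `A`-algebra `B` at (the image of) `f ∈ A`, as an algebra
over `A[1/f]`, in the form `A[1/f] ⊗ B`. -/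
abbrev AwayAlg (f : A) : Type (max u v) :=
  Localization.Away f ⊗[A] B

/-- The canonical map `B[1/f] → B[1/g]` for `f ∣ g`. -/
noncomputable def awayAlgRes {f g : A} (h : f ∣ g) : AwayAlg B f →ₐ[A] AwayAlg B g :=
  Algebra.TensorProduct.map (awayRes h) (AlgHom.id A B)

variable (A)

/-- A (`𝔾ₘ`-)twisted monogenerator of `B / A`, on a cover indexed by `ι`: a cover of `Spec A` by
basic open sets `D(fᵢ)`, monogenerators `θᵢ` of `B[1/fᵢ]` over `A[1/fᵢ]`, and units `aᵢⱼ` of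
`A[1/fᵢ, 1/fⱼ]` with `aᵢⱼ θⱼ = θᵢ` in `B[1/fᵢ, 1/fⱼ]` and `aᵢⱼ aⱼₖ = aᵢₖ` in
`A[1/fᵢ, 1/fⱼ, 1/fₖ]`. -/
structure TwistedMonogenerator (ι : Type u) where
  f : ι → A
  cover : ⨆ i, PrimeSpectrum.basicOpen (f i) = ⊤
  θ : ∀ i, AwayAlg B (f i)
  isMonogenerator : ∀ i, IsMonogenerator (Localization.Away (f i)) (θ i)
  a : ∀ i j, (Localization.Away (f i * f j))ˣ
  smul_eq : ∀ i j,
    (a i j : Localization.Away (f i * f j)) •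
        awayAlgRes B (Dvd.intro_left (f i) rfl : f j ∣ f i * f j) (θ j) =
      awayAlgRes B (Dvd.intro (f j) rfl : f i ∣ f i * f j) (θ i)
  cocycle : ∀ i j k,
    awayRes (Dvd.intro (f k) rfl : f i * f j ∣ f i * f j * f k) (a i j) *
        awayRes (Dvd.intro_left (f i) (mul_assoc _ _ _).symm : f j * f k ∣ f i * f j * f k)
          (a j k) =
      awayRes (Dvd.intro (f j) (mul_right_comm _ _ _) : f i * f k ∣ f i * f j * f k) (a i k)

/-- `B / A` is twisted monogenic: it has a `𝔾ₘ`-twisted monogenerator on some cover. -/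
def IsTwistedMonogenic : Prop :=
  ∃ ι : Type u, Nonempty (TwistedMonogenerator A B ι)

end TwistedMonogenicity

/-!
Over a principal ideal domain the transition units of a twisted monogenerator form a coboundary:
inside the fraction field, a generator of a suitable fractional ideal splits the cocycle. Rescaling
the local monogenerators by the resulting units makes them glue to a global one.

Conversely, let `d ≡ 1 mod 4` and `(d) = J²S` with `S` squarefree. With `ω = (d + √d) / 2`, the
integral closure of `A` in `K(√d)` is `A ⊕ J⁻¹ω`. As `J⁻¹` is locally free of rank one, this ring
is twisted monogenic, while a global monogenerator would exhibit a generator of `J⁻¹`; hence all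
these `J` are principal. They suffice: the primes `P` prime to `4` generate the class group, and
for each of them there are `d₁, d₂ ≡ 1 mod 4`, both divisible by `P` exactly once and with no other
prime in common, so that the square part of `d₁d₂` is `P` times those of `d₁` and `d₂`.
-/

section Gluing

open Filter

variable {A : Type u} [CommRing A] {B : Type v} [CommRing B] [Algebra A B]

@[simp]
theorem awayAlgRes_one_tmul {f g : A} (h : f ∣ g) (b : B) :
    awayAlgRes B h (1 ⊗ₜ b) = 1 ⊗ₜ b := by
  simp [awayAlgRes]

theorem awayAlgRes_smul {f g : A} (h : f ∣ g) (r : Localization.Away f) (y : AwayAlg B f) :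
    awayAlgRes B h (r • y) = awayRes h r • awayAlgRes B h y := by
  induction y using TensorProduct.induction_on with
  | zero => simp
  | add y z hy hz => rw [smul_add, map_add, hy, hz, map_add, smul_add]
  | tmul s b => simp [awayAlgRes, TensorProduct.smul_tmul']

theorem eventually_pow_smul_eq_one_tmul {f : A} (y : AwayAlg B f) :
    ∀ᶠ n in atTop, ∃ b : B, f ^ n • y = 1 ⊗ₜ b := by
  obtain ⟨n, b, hb⟩ := IsLocalizedModule.Away.surj (r := f)
    (f := TensorProduct.mk A (Localization.Away f) B 1) y
  filter_upwards [eventually_ge_atTop n] with m hm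
  refine ⟨f ^ (m - n) • b, ?_⟩
  rw [← Nat.sub_add_cancel hm, pow_add, mul_smul, hb, TensorProduct.tmul_smul]
  simp

theorem eventually_pow_smul_eq_pow_smul {f : A} {b b' : B}
    (h : (1 ⊗ₜ b : AwayAlg B f) = 1 ⊗ₜ b') : ∀ᶠ n in atTop, f ^ n • b = f ^ n • b' := by
  obtain ⟨n, hn⟩ := IsLocalizedModule.Away.exists_of_eq (r := f)
    (f := TensorProduct.mk A (Localization.Away f) B 1) h
  filter_upwards [eventually_ge_atTop n] with m hm
  rw [← Nat.sub_add_cancel hm, pow_add, mul_smul, hn, mul_smul]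

theorem pow_smul_left_cancel_awayAlg {f : A} (n : ℕ) {y z : AwayAlg B f} :
    f ^ n • y = f ^ n • z ↔ y = z := by
  rw [← algebraMap_smul (Localization.Away f) _ y, ← algebraMap_smul (Localization.Away f) _ z,
    map_pow]
  exact ((IsLocalization.Away.algebraMap_isUnit f).pow n).smul_left_cancel

theorem exists_forall_smul_eq_of_span_eq_top {ι M : Type*} [Finite ι] [AddCommGroup M]
    [Module A M] {g : ι → A} (hg : Ideal.span (Set.range g) = ⊤) {x : ι → M}
    (h : ∀ i j, g j • x i = g i • x j) : ∃ t, ∀ j, g j • t = x j := by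
  have := Fintype.ofFinite ι
  obtain ⟨r, hr⟩ := (Ideal.mem_span_range_iff_exists_fun (x := 1)).1 (hg ▸ Submodule.mem_top)
  refine ⟨∑ i, r i • x i, fun j => ?_⟩
  calc g j • ∑ i, r i • x i = ∑ i, (r i * g i) • x j := by
        simp only [Finset.smul_sum, smul_comm (g j), h _ j, smul_smul]
    _ = x j := by rw [← Finset.sum_smul, hr, one_smul]

theorem exists_forall_one_tmul_eq {ι : Type*} [Finite ι] {f : ι → A}
    (hf : Ideal.span (Set.range f) = ⊤) {τ : ∀ i, AwayAlg B (f i)}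
    (hτ : ∀ i j, awayAlgRes B (Dvd.intro_left (f i) rfl : f j ∣ f i * f j) (τ j) =
      awayAlgRes B (Dvd.intro (f j) rfl : f i ∣ f i * f j) (τ i)) :
    ∃ t : B, ∀ i, 1 ⊗ₜ t = τ i := by
  obtain ⟨n, hn⟩ := (eventually_all.2 fun i => eventually_pow_smul_eq_one_tmul (τ i)).exists
  choose b hb using hn
  have hres (i j) : (1 ⊗ₜ (f j ^ n • b i) : AwayAlg B (f i * f j)) = 1 ⊗ₜ (f i ^ n • b j) := by
    rw [TensorProduct.tmul_smul, TensorProduct.tmul_smul,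
      ← awayAlgRes_one_tmul (Dvd.intro (f j) rfl : f i ∣ f i * f j),
      ← awayAlgRes_one_tmul (Dvd.intro_left (f i) rfl : f j ∣ f i * f j), ← hb, ← hb, map_smul,
      map_smul, hτ, smul_comm]
  obtain ⟨m, hm⟩ := (eventually_all.2 fun i => eventually_all.2 fun j =>
    eventually_pow_smul_eq_pow_smul (hres i j)).exists
  have hspan : Ideal.span (Set.range fun i => f i ^ (n + m)) = ⊤ := by
    simpa only [← Set.range_comp, Function.comp_def] using Ideal.span_pow_eq_top _ hf (n + m)
  obtain ⟨t, ht⟩ := exists_forall_smul_eq_of_span_eq_top hspan (x := fun i => f i ^ m • b i)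
    fun i j => by
      have h := hm i j
      simp only [smul_smul] at h ⊢
      convert h using 2 <;> ring
  refine ⟨t, fun i => (pow_smul_left_cancel_awayAlg (n + m)).1 ?_⟩
  rw [← TensorProduct.tmul_smul, ht, TensorProduct.tmul_smul, ← hb, smul_smul, pow_add, mul_comm]

theorem baseChange_adjoin_singleton (R : Type*) [CommRing R] [Algebra A R] (x : B) :
    (Algebra.adjoin A {x}).baseChange R = Algebra.adjoin R {(1 ⊗ₜ x : R ⊗[A] B)} := by
  refine le_antisymm ?_ (Algebra.adjoin_le ?_)
  · have hmap : (Algebra.adjoin A {x}).map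
        (Algebra.TensorProduct.includeRight : B →ₐ[A] R ⊗[A] B) ≤
        (Algebra.adjoin R {(1 ⊗ₜ x : R ⊗[A] B)}).restrictScalars A := by
      rw [AlgHom.map_adjoin_singleton]
      exact Algebra.adjoin_le Algebra.subset_adjoin
    rintro _ ⟨z, rfl⟩
    induction z using TensorProduct.induction_on with
    | zero => simp
    | add y z hy hz => rw [map_add]; exact add_mem hy hz
    | tmul r c =>
      have hc : (1 ⊗ₜ (c : B) : R ⊗[A] B) ∈ Algebra.adjoin R {(1 ⊗ₜ x : R ⊗[A] B)} :=
        hmap ⟨c, c.2, rfl⟩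
      simpa [TensorProduct.smul_tmul'] using Subalgebra.smul_mem _ hc r
  · exact Set.singleton_subset_iff.2
      (Subalgebra.tmul_mem_baseChange (Algebra.self_mem_adjoin_singleton A x) 1)

theorem isMonogenerator_one_tmul_iff {f : A} {x : B} :
    IsMonogenerator (Localization.Away f) (1 ⊗ₜ x : AwayAlg B f) ↔
      ∀ b, ∃ n, f ^ n • b ∈ Algebra.adjoin A {x} := by
  rw [IsMonogenerator, ← baseChange_adjoin_singleton, eq_top_iff]
  generalize Algebra.adjoin A {x} = S
  refine ⟨fun h b => ?_, fun h y _ => ?_⟩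
  · obtain ⟨z, hz⟩ := h (x := 1 ⊗ₜ b) trivial
    obtain ⟨n, c, hc⟩ := (eventually_pow_smul_eq_one_tmul z).exists
    have hbc : (1 ⊗ₜ (f ^ n • b) : AwayAlg B f) = 1 ⊗ₜ (c : B) := by
      have := congrArg (Algebra.TensorProduct.map (AlgHom.id A (Localization.Away f)) S.val) hc
      rw [map_smul] at this
      rw [TensorProduct.tmul_smul, ← hz]
      exact this
    obtain ⟨m, hm⟩ := (eventually_pow_smul_eq_pow_smul hbc).exists
    refine ⟨m + n, ?_⟩
    rw [pow_add, mul_smul, hm]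
    exact S.smul_mem c.2 _
  · obtain ⟨n, b, hb⟩ := (eventually_pow_smul_eq_one_tmul y).exists
    obtain ⟨m, hm⟩ := h b
    have hy : f ^ (m + n) • y ∈ S.baseChange (Localization.Away f) := by
      rw [pow_add, mul_smul, hb, ← TensorProduct.tmul_smul]
      exact Subalgebra.tmul_mem_baseChange hm 1
    rw [← algebraMap_smul (Localization.Away f), map_pow] at hy
    exact (Submodule.smul_mem_iff_of_isUnit
      (Subalgebra.toSubmodule (S.baseChange (Localization.Away f)))
      ((IsLocalization.Away.algebraMap_isUnit f).pow _)).1 hy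

theorem isMonogenerator_of_forall_away {ι : Type*} {f : ι → A}
    (hf : Ideal.span (Set.range f) = ⊤) {x : B}
    (h : ∀ i, IsMonogenerator (Localization.Away (f i)) (1 ⊗ₜ x : AwayAlg B (f i))) :
    IsMonogenerator A x := by
  refine eq_top_iff.2 fun b _ => ?_
  refine Submodule.mem_of_span_eq_top_of_smul_pow_mem
    (Subalgebra.toSubmodule (Algebra.adjoin A {x})) _ hf _ ?_
  rintro ⟨_, i, rfl⟩
  exact isMonogenerator_one_tmul_iff.1 (h i) b

end Gluing

section Units

open Filter

variable {A : Type u} [CommRing A] [IsDomain A] {f g : A}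

theorem isPrincipal_span_range [IsBezout A] {K : Type*} [Field K] [Algebra A K]
    [IsFractionRing A K] {ι : Type*} [Finite ι] (x : ι → K) :
    (Submodule.span A (Set.range x)).IsPrincipal := by
  obtain ⟨b, hb⟩ := IsLocalization.exist_integer_multiples_of_finite (nonZeroDivisors A) x
  choose y hy using hb
  have hb0 : algebraMap A K b ≠ 0 := IsFractionRing.to_map_ne_zero_of_mem_nonZeroDivisors b.2
  let φ : A →ₗ[A] K := (algebraMap A K b)⁻¹ • Algebra.linearMap A K
  have hφ : Set.range x = φ '' Set.range y := by
    rw [← Set.range_comp]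
    congr 1
    ext i
    simp [φ, hy, Algebra.smul_def, hb0]
  rw [hφ, ← Submodule.map_span]
  exact (IsBezout.isPrincipal_of_FG _ (Submodule.fg_span (Set.finite_range y))).map φ

/-- The inclusion `A[1/f] → Frac A`, for `f ≠ 0`. -/
noncomputable def awayToFractionRing (hf : f ≠ 0) : Localization.Away f →ₐ[A] FractionRing A :=
  IsLocalization.liftAlgHom (M := Submonoid.powers f) (f := Algebra.ofId A (FractionRing A)) (by
    rintro ⟨_, n, rfl⟩
    rw [map_pow]
    exact (IsUnit.mk0 _ (IsFractionRing.to_map_eq_zero_iff.not.2 hf)).pow n)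

theorem awayToFractionRing_injective (hf : f ≠ 0) : Function.Injective (awayToFractionRing hf) := by
  refine (IsLocalization.lift_injective_iff _).2 fun a b => ?_
  rw [(IsLocalization.injective _ (powers_le_nonZeroDivisors_of_noZeroDivisors hf)).eq_iff]
  exact (FaithfulSMul.algebraMap_injective A (FractionRing A)).eq_iff.symm

theorem awayToFractionRing_awayRes (hf : f ≠ 0) (hg : g ≠ 0) (h : f ∣ g)
    (x : Localization.Away f) :
    awayToFractionRing hg (awayRes h x) = awayToFractionRing hf x :=
  have := IsLocalization.algHom_subsingleton (R := A) (S := Localization.Away f)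
    (P := FractionRing A) (Submonoid.powers f)
  DFunLike.congr_fun (Subsingleton.elim ((awayToFractionRing hg).comp (awayRes h)) _) x

theorem mem_range_awayToFractionRing_iff (hf : f ≠ 0) {x : FractionRing A} :
    x ∈ (awayToFractionRing hf).range ↔ ∃ (n : ℕ) (a : A), f ^ n • x = algebraMap A _ a := by
  rw [AlgHom.mem_range]
  constructor
  · rintro ⟨y, rfl⟩
    obtain ⟨⟨a, _, n, rfl⟩, h⟩ := IsLocalization.surj (Submonoid.powers f) y
    refine ⟨n, a, ?_⟩
    change y * algebraMap A _ (f ^ n) = algebraMap A _ a at h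
    rw [← (awayToFractionRing hf).commutes, ← h, map_mul, AlgHom.commutes, Algebra.smul_def,
      mul_comm]
  · rintro ⟨n, a, h⟩
    refine ⟨IsLocalization.mk' _ a (⟨f ^ n, n, rfl⟩ : Submonoid.powers f), ?_⟩
    refine mul_left_cancel₀ (IsFractionRing.to_map_eq_zero_iff.not.2 (pow_ne_zero n hf)) ?_
    rw [← Algebra.smul_def _ x, h, ← (awayToFractionRing hf).commutes,
      ← (awayToFractionRing hf).commutes, ← map_mul,
      ← IsLocalization.mk'_spec' (Localization.Away f) a
      (⟨f ^ n, n, rfl⟩ : Submonoid.powers f)]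

theorem eventually_pow_smul_mem_range_awayToFractionRing (hf : f ≠ 0) (hg : g ≠ 0)
    (x : Localization.Away (f * g)) :
    ∀ᶠ n in atTop, f ^ n • awayToFractionRing (mul_ne_zero hf hg) x ∈
      (awayToFractionRing hg).range := by
  obtain ⟨n, a, h⟩ := (mem_range_awayToFractionRing_iff (mul_ne_zero hf hg)).1 ⟨x, rfl⟩
  filter_upwards [eventually_ge_atTop n] with m hm
  refine (mem_range_awayToFractionRing_iff hg).2 ⟨n, f ^ (m - n) * a, ?_⟩
  rw [map_mul, ← Algebra.smul_def, ← h, smul_smul, smul_smul]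
  congr 1
  obtain ⟨k, rfl⟩ := Nat.exists_eq_add_of_le hm
  rw [Nat.add_sub_cancel_left]
  ring

theorem exists_units_awayToFractionRing_eq_mul [IsBezout A] {ι : Type*} [Finite ι] {f : ι → A}
    (hf : ∀ i, f i ≠ 0) {c : ι → FractionRing A} (hc : ∀ i, c i ≠ 0) {N : ℕ}
    (h : ∀ i j, f i ^ N • (c j / c i) ∈ (awayToFractionRing (hf j)).range) :
    ∃ (w : FractionRing A) (u : ∀ i, (Localization.Away (f i))ˣ),
      ∀ i, awayToFractionRing (hf i) (u i) = c i * w := by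
  obtain ⟨w, hw⟩ := isPrincipal_span_range (A := A) fun i => f i ^ N • (c i)⁻¹
  have hcw (j) : c j * w ∈ (awayToFractionRing (hf j)).range := by
    suffices hle : Submodule.span A {w} ≤
        (awayToFractionRing (hf j)).range.toSubmodule.comap (LinearMap.mulLeft A (c j)) from
      hle (Submodule.mem_span_singleton_self w)
    rw [← hw, Submodule.span_le]
    rintro _ ⟨i, rfl⟩
    change c j * f i ^ N • (c i)⁻¹ ∈ (awayToFractionRing (hf j)).range
    rw [mul_smul_comm, ← div_eq_mul_inv]
    exact h i j
  have hs (j) : ∃ s : A, s • w = f j ^ N • (c j)⁻¹ :=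
    Submodule.mem_span_singleton.1 (hw ▸ Submodule.subset_span ⟨j, rfl⟩)
  simp only [AlgHom.mem_range] at hcw
  choose u hu using hcw
  choose s hs using hs
  have hus (j) : u j * algebraMap A _ (s j) = algebraMap A _ (f j) ^ N :=
    awayToFractionRing_injective (hf j) <| by
      rw [map_mul, hu, AlgHom.commutes, map_pow, AlgHom.commutes, ← map_pow, mul_assoc, mul_comm w,
        ← Algebra.smul_def, hs, mul_smul_comm, mul_inv_cancel₀ (hc j), Algebra.smul_def, mul_one]
  have hunit (j) : IsUnit (u j) := isUnit_of_mul_isUnit_left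
    (hus j ▸ (IsLocalization.Away.algebraMap_isUnit (f j)).pow N)
  exact ⟨w, fun j => (hunit j).unit, hu⟩

theorem exists_units_of_cocycle [IsBezout A] {ι : Type*} [Finite ι] {f : ι → A} (hf : ∀ i, f i ≠ 0)
    (a : ∀ i j, (Localization.Away (f i * f j))ˣ)
    (ha : ∀ i j k, awayRes (Dvd.intro (f k) rfl : f i * f j ∣ f i * f j * f k) (a i j) *
        awayRes (Dvd.intro_left (f i) (mul_assoc _ _ _).symm : f j * f k ∣ f i * f j * f k)
          (a j k) =
      awayRes (Dvd.intro (f j) (mul_right_comm _ _ _) : f i * f k ∣ f i * f j * f k) (a i k)) :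
    ∃ u : ∀ i, (Localization.Away (f i))ˣ, ∀ i j,
      awayRes (Dvd.intro (f j) rfl : f i ∣ f i * f j) (u i) =
        a i j * awayRes (Dvd.intro_left (f i) rfl : f j ∣ f i * f j) (u j) := by
  rcases isEmpty_or_nonempty ι with hι | ⟨⟨i₀⟩⟩
  · exact ⟨isEmptyElim, isEmptyElim⟩
  have hff (i j) : f i * f j ≠ 0 := mul_ne_zero (hf i) (hf j)
  let c (i j) : FractionRing A := awayToFractionRing (hff i j) (a i j)
  have hc (i j) : c i j ≠ 0 := ((a i j).isUnit.map (awayToFractionRing (hff i j))).ne_zero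
  have hcoc (i j k) : c i j * c j k = c i k := by
    have := congrArg (awayToFractionRing (mul_ne_zero (hff i j) (hf k))) (ha i j k)
    rwa [map_mul, awayToFractionRing_awayRes (hff i j), awayToFractionRing_awayRes (hff j k),
      awayToFractionRing_awayRes (hff i k)] at this
  obtain ⟨N, hN⟩ := (eventually_all.2 fun i => eventually_all.2 fun j =>
    eventually_pow_smul_mem_range_awayToFractionRing (hf i) (hf j)
      (awayRes (mul_comm (f j) (f i)).dvd (a j i))).exists
  simp only [awayToFractionRing_awayRes (hff _ _)] at hN
  change ∀ i j, f i ^ N • c j i ∈ _ at hN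
  obtain ⟨w, u, hu⟩ := exists_units_awayToFractionRing_eq_mul hf (hc · i₀) (N := N) fun i j => by
    rw [← hcoc j i i₀, mul_div_cancel_right₀ _ (hc i i₀)]
    exact hN i j
  refine ⟨u, fun i j => awayToFractionRing_injective (hff i j) ?_⟩
  rw [map_mul, awayToFractionRing_awayRes (hf i), awayToFractionRing_awayRes (hf j), hu, hu,
    ← mul_assoc]
  exact congrArg (· * w) (hcoc i j i₀).symm

end Units

section Bezout

variable {A : Type u} [CommRing A] {B : Type v} [CommRing B] [Algebra A B]

theorem TwistedMonogenerator.span_range_f {ι : Type u} (T : TwistedMonogenerator A B ι) :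
    Ideal.span (Set.range T.f) = ⊤ :=
  PrimeSpectrum.iSup_basicOpen_eq_top_iff.1 T.cover

/-- The restriction of a twisted monogenerator along a map of index sets whose image still
covers. -/
def TwistedMonogenerator.reindex {ι κ : Type u} (T : TwistedMonogenerator A B ι) (e : κ → ι)
    (he : Ideal.span (Set.range (T.f ∘ e)) = ⊤) : TwistedMonogenerator A B κ where
  f := T.f ∘ e
  cover := PrimeSpectrum.iSup_basicOpen_eq_top_iff.2 he
  θ i := T.θ (e i)
  isMonogenerator i := T.isMonogenerator (e i)
  a i j := T.a (e i) (e j)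
  smul_eq i j := T.smul_eq (e i) (e j)
  cocycle i j k := T.cocycle (e i) (e j) (e k)

theorem IsTwistedMonogenic.exists_finite (h : IsTwistedMonogenic A B) :
    ∃ (ι : Type u) (_ : Finite ι) (T : TwistedMonogenerator A B ι), ∀ i, T.f i ≠ 0 := by
  obtain ⟨ι, ⟨T⟩⟩ := h
  obtain ⟨s, hsT, hs⟩ := (Ideal.span_eq_top_iff_finite _).1 T.span_range_f
  choose e he using fun x : ((s : Set A) \ {0} : Set A) => hsT x.2.1
  have hspan : Ideal.span (Set.range (T.f ∘ e)) = ⊤ := by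
    have hrange : Set.range (T.f ∘ e) = (s : Set A) \ {0} := by
      rw [funext he (f := T.f ∘ e)]
      exact Subtype.range_coe
    rw [hrange, Ideal.span_sdiff_singleton_zero, hs]
  exact ⟨_, s.finite_toSet.sdiff.to_subtype, T.reindex e hspan, fun i => (he i).trans_ne i.2.2⟩

theorem IsMonogenerator.units_smul {θ : B} (h : IsMonogenerator A θ) (u : Aˣ) :
    IsMonogenerator A (u • θ) := by
  rw [IsMonogenerator, eq_top_iff, ← h]
  refine Algebra.adjoin_singleton_le ?_
  have hmem := Subalgebra.smul_mem _ (Algebra.self_mem_adjoin_singleton A (u • θ)) (↑u⁻¹ : A)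
  rwa [← Units.smul_def, inv_smul_smul] at hmem

theorem IsTwistedMonogenic.isMonogenic [IsDomain A] [IsBezout A] (h : IsTwistedMonogenic A B) :
    IsMonogenic A B := by
  obtain ⟨ι, _, T, hf⟩ := h.exists_finite
  obtain ⟨u, hu⟩ := exists_units_of_cocycle hf T.a T.cocycle
  have hl (i j) : T.f i ∣ T.f i * T.f j := dvd_mul_right _ _
  have hr (i j) : T.f j ∣ T.f i * T.f j := dvd_mul_left _ _
  have hinv (i j) : Units.map (awayRes (hr i j)) (u j)⁻¹ =
      Units.map (awayRes (hl i j)) (u i)⁻¹ * T.a i j := by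
    rw [map_inv, map_inv, eq_inv_mul_iff_mul_eq, ← div_eq_mul_inv, div_eq_iff_eq_mul]
    exact Units.ext (hu i j)
  have hinv' (i j) := congrArg Units.val (hinv i j)
  simp only [Units.val_mul, Units.coe_map, MonoidHom.coe_coe] at hinv'
  obtain ⟨t, ht⟩ := exists_forall_one_tmul_eq T.span_range_f (τ := fun i => (u i)⁻¹ • T.θ i)
    fun i j => by
      rw [Units.smul_def, Units.smul_def, awayAlgRes_smul, awayAlgRes_smul, hinv', mul_smul,
        T.smul_eq]
  exact ⟨t, isMonogenerator_of_forall_away T.span_range_f fun i =>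
    ht i ▸ (T.isMonogenerator i).units_smul _⟩

end Bezout

section SquarefreePart

variable {M : Type*} [CommMonoidWithZero M]

theorem exists_eq_sq_mul_squarefree [UniqueFactorizationMonoid M] {a : M} (ha : a ≠ 0) :
    ∃ b s, a = b ^ 2 * s ∧ Squarefree s := by
  induction a using UniqueFactorizationMonoid.induction_on_prime with
  | h₁ => exact absurd rfl ha
  | h₂ x hx => exact ⟨1, x, by simp, hx.squarefree⟩
  | h₃ a p ha' hp ih =>
    obtain ⟨b, s, rfl, hs⟩ := ih ha'
    by_cases h : p ∣ s
    · obtain ⟨s, rfl⟩ := h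
      exact ⟨p * b, s, by rw [mul_pow, sq p]; ac_rfl, hs.squarefree_of_dvd (dvd_mul_left s p)⟩
    · exact ⟨b, p * s, mul_left_comm _ _ _, squarefree_mul_iff.2
        ⟨hp.irreducible.isRelPrime_iff_not_dvd.2 h, hp.squarefree, hs⟩⟩

theorem dvd_of_sq_dvd_sq_mul_squarefree [GCDMonoid M] {a b s : M} (hs : Squarefree s)
    (h : b ^ 2 ∣ a ^ 2 * s) : b ∣ a := by
  obtain ⟨a', b', ha, hb, hu⟩ := extract_gcd a b
  by_cases h0 : gcd a b = 0
  · simp [((gcd_eq_zero_iff a b).1 h0).1]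
  have h' : b' ^ 2 ∣ a' ^ 2 * s := by
    refine (mul_dvd_mul_iff_left (pow_ne_zero 2 h0)).1 ?_
    rwa [← mul_pow, ← mul_assoc, ← mul_pow, ← ha, ← hb]
  have hb' : IsUnit b' :=
    hs b' (sq b' ▸ ((gcd_isUnit_iff_isRelPrime.1 hu).symm.pow).dvd_of_dvd_mul_left h')
  rw [hb, hb'.mul_right_dvd]
  exact gcd_dvd_left a b

end SquarefreePart

section DedekindDomain

theorem isPrincipal_mul {A : Type*} [CommRing A] {I J : Ideal A} (hI : I.IsPrincipal)
    (hJ : J.IsPrincipal) : (I * J).IsPrincipal := by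
  obtain ⟨x, rfl⟩ := hI
  obtain ⟨y, rfl⟩ := hJ
  exact ⟨x * y, Ideal.span_singleton_mul_span_singleton x y⟩

variable {A : Type*} [CommRing A] [IsDedekindDomain A]

theorem isPrincipal_of_isPrincipal_mul {I J : Ideal A} (hJ0 : J ≠ ⊥) (hJ : J.IsPrincipal)
    (h : (I * J).IsPrincipal) : I.IsPrincipal := by
  obtain ⟨y, rfl⟩ := hJ
  obtain ⟨x, hx⟩ := h
  obtain ⟨z, -, rfl⟩ := Ideal.mem_mul_span_singleton.1 (hx.ge (Submodule.mem_span_singleton_self x))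
  refine ⟨z, mul_right_cancel₀ hJ0 (hx.trans ?_)⟩
  exact (Ideal.span_singleton_mul_span_singleton z y).symm

theorem isPrincipal_of_isCoprime_of_forall_prime {I M : Ideal A}
    (H : ∀ P : Ideal A, Prime P → IsCoprime P M → P.IsPrincipal) (h : IsCoprime I M) :
    I.IsPrincipal := by
  induction I using UniqueFactorizationMonoid.induction_on_prime with
  | h₁ => exact ⟨0, by simp⟩
  | h₂ I hI => exact ⟨1, by simpa using hI⟩
  | h₃ I P _ hP ih =>
    exact isPrincipal_mul (H P hP h.of_mul_left_left) (ih h.of_mul_left_right)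

theorem exists_mul_isPrincipal_isCoprime {I M : Ideal A} (hI : I ≠ ⊥) (hM : M ≠ ⊥) :
    ∃ J, (I * J).IsPrincipal ∧ IsCoprime J M := by
  obtain ⟨x, hx⟩ := IsDedekindDomain.exists_sup_span_eq (Ideal.mul_le_left : I * M ≤ I)
    (mul_ne_zero hI hM)
  obtain ⟨J, hJ⟩ : I ∣ Ideal.span {x} := Ideal.dvd_iff_le.2 (hx ▸ le_sup_right)
  refine ⟨J, hJ ▸ ⟨x, rfl⟩, Ideal.isCoprime_iff_sup_eq.2 (mul_left_cancel₀ hI ?_)⟩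
  rw [Ideal.mul_sup, ← hJ, sup_comm, hx, Ideal.mul_top]

theorem isPrincipalIdealRing_of_forall_prime_isCoprime {M : Ideal A} (hM : M ≠ ⊥)
    (H : ∀ P : Ideal A, Prime P → IsCoprime P M → P.IsPrincipal) : IsPrincipalIdealRing A := by
  refine ⟨fun I => ?_⟩
  by_cases hI : I = ⊥
  · exact hI ▸ inferInstance
  obtain ⟨J, hIJ, hJ⟩ := exists_mul_isPrincipal_isCoprime hI hM
  by_cases hJ0 : J = ⊥
  · exact isPrincipal_of_isCoprime_of_forall_prime H
      (hJ.of_isCoprime_of_dvd_left (hJ0 ▸ dvd_zero I))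
  · exact isPrincipal_of_isPrincipal_mul hJ0 (isPrincipal_of_isCoprime_of_forall_prime H hJ) hIJ

theorem exists_mem_prime_notMem_sq {P M : Ideal A} (hP : Prime P) (hM : IsCoprime P M) :
    ∃ d ∈ P, d ∉ P ^ 2 ∧ d - 1 ∈ M := by
  obtain ⟨p, hp, hp'⟩ := Ideal.exists_mem_pow_notMem_pow_succ P hP.ne_zero
    (fun h => hP.not_isUnit (Ideal.isUnit_iff.2 h)) 1
  rw [pow_one] at hp
  obtain ⟨u, hu, v, hv, huv⟩ := Ideal.isCoprime_iff_exists.1 (hM.pow_left (m := 2))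
  refine ⟨p * v + u, ?_, fun h => hp' ?_, ?_⟩
  · exact add_mem (Ideal.mul_mem_right _ _ hp) (Ideal.pow_le_self two_ne_zero hu)
  · rw [show p = p * v + u - (1 - p) * u by linear_combination -p * huv]
    exact sub_mem h (Ideal.mul_mem_left _ _ hu)
  · rw [show p * v + u - 1 = (p - 1) * v by linear_combination huv]
    exact Ideal.mul_mem_left _ _ hv

/-- The ideal `(d)` is `J²` times a squarefree ideal: `J²` is the largest square dividing `(d)`. -/
def IsSquarePart (d : A) (J : Ideal A) : Prop :=
  ∃ S, Squarefree S ∧ Ideal.span {d} = J ^ 2 * S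

theorem exists_span_eq_sq_mul_prime_mul {P : Ideal A} (hP : Prime P) {d : A} (hd : d ∈ P)
    (hd' : d ∉ P ^ 2) :
    ∃ J S, Squarefree (P * S) ∧ Ideal.span {d} = J ^ 2 * (P * S) ∧ IsCoprime P (J ^ 2 * S) := by
  obtain ⟨C, hC⟩ : P ∣ Ideal.span {d} := Ideal.dvd_span_singleton.2 hd
  have hPC : ¬ P ∣ C := by
    rintro ⟨C, rfl⟩
    rw [← mul_assoc, ← sq] at hC
    exact hd' (Ideal.dvd_span_singleton.1 ⟨C, hC⟩)
  have hC0 : C ≠ 0 := fun h => hPC (h ▸ dvd_zero P)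
  obtain ⟨J, S, rfl, hS⟩ := exists_eq_sq_mul_squarefree hC0
  have hPS : IsRelPrime P S :=
    hP.irreducible.isRelPrime_iff_not_dvd.2 fun h => hPC (h.mul_left _)
  have hmax : P.IsMaximal := (Ideal.isPrime_of_prime hP).isMaximal hP.ne_zero
  exact ⟨J, S, squarefree_mul_iff.2 ⟨hPS, hP.squarefree, hS⟩, hC.trans (mul_left_comm _ _ _),
    Ideal.isCoprime_iff_codisjoint.2 <| hmax.out.not_le_iff_codisjoint.1 fun h =>
      hPC (Ideal.dvd_iff_le.2 h)⟩

theorem exists_isSquarePart_prime_mul {P M : Ideal A} (hP : Prime P) (hM : IsCoprime P M) :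
    ∃ d₁ d₂ J₁ J₂, d₁ - 1 ∈ M ∧ d₂ - 1 ∈ M ∧ d₁ * d₂ ≠ 0 ∧
      IsSquarePart d₁ J₁ ∧ IsSquarePart d₂ J₂ ∧ IsSquarePart (d₁ * d₂) (P * (J₁ * J₂)) := by
  obtain ⟨d₁, hd₁, hd₁', hd₁M⟩ := exists_mem_prime_notMem_sq hP hM
  obtain ⟨J₁, S₁, hS₁, e₁, hc₁⟩ := exists_span_eq_sq_mul_prime_mul hP hd₁ hd₁'
  obtain ⟨d₂, hd₂, hd₂', hd₂M⟩ := exists_mem_prime_notMem_sq hP (hM.mul_right hc₁)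
  obtain ⟨J₂, S₂, hS₂, e₂, -⟩ := exists_span_eq_sq_mul_prime_mul hP hd₂ hd₂'
  have hS : IsCoprime S₁ S₂ := by
    refine Ideal.isCoprime_iff_exists.2 ⟨1 - d₂, ?_, d₂, ?_, by ring⟩
    · rw [← neg_sub]
      exact neg_mem (Ideal.mul_le_right (Ideal.mul_le_right hd₂M))
    · rw [← Ideal.dvd_span_singleton, e₂]
      exact (dvd_mul_left S₂ P).mul_left _
  refine ⟨d₁, d₂, J₁, J₂, hd₁M, Ideal.mul_le_left hd₂M, mul_ne_zero ?_ ?_, ⟨_, hS₁, e₁⟩,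
    ⟨_, hS₂, e₂⟩, S₁ * S₂, squarefree_mul_iff.2 ⟨hS.isRelPrime, hS₁.of_mul_right,
      hS₂.of_mul_right⟩, ?_⟩
  · exact fun h => hd₁' (h ▸ zero_mem _)
  · exact fun h => hd₂' (h ▸ zero_mem _)
  · rw [← Ideal.span_singleton_mul_span_singleton, e₁, e₂]
    ring

theorem isPrincipalIdealRing_of_forall_isSquarePart {M : Ideal A} (hM : M ≠ ⊥)
    (H : ∀ (d : A) (J : Ideal A), d - 1 ∈ M → IsSquarePart d J → J.IsPrincipal) :
    IsPrincipalIdealRing A := by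
  refine isPrincipalIdealRing_of_forall_prime_isCoprime hM fun P hP hPM => ?_
  obtain ⟨d₁, d₂, J₁, J₂, h₁, h₂, h0, hJ₁, hJ₂, hJ⟩ := exists_isSquarePart_prime_mul hP hPM
  have h₁₂ : d₁ * d₂ - 1 ∈ M := by
    rw [show d₁ * d₂ - 1 = d₂ * (d₁ - 1) + (d₂ - 1) by ring]
    exact add_mem (Ideal.mul_mem_left _ _ h₁) h₂
  refine isPrincipal_of_isPrincipal_mul (J := J₁ * J₂) ?_
    (isPrincipal_mul (H d₁ J₁ h₁ hJ₁) (H d₂ J₂ h₂ hJ₂)) (H _ _ h₁₂ hJ)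
  intro hbot
  obtain ⟨S, -, hS⟩ := hJ
  exact h0 (by simpa [hbot] using hS)

end DedekindDomain

section RankOne

variable {A : Type u} [CommRing A]

/-- A divisor `a` of `f`, as a unit of `A[1/f]`. -/
noncomputable def awayUnit {a f : A} (h : a ∣ f) : (Localization.Away f)ˣ :=
  (isUnit_of_dvd_unit (map_dvd (algebraMap A _) h) (IsLocalization.Away.algebraMap_isUnit f)).unit

@[simp]
theorem val_awayUnit {a f : A} (h : a ∣ f) :
    (awayUnit h : Localization.Away f) = algebraMap A _ a :=
  rfl

theorem awayUnit_mul_awayUnit {a b c d f : A} (ha : a ∣ f) (hb : b ∣ f) (hc : c ∣ f) (hd : d ∣ f)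
    (h : a * b = c * d) : awayUnit ha * awayUnit hb = awayUnit hc * awayUnit hd := by
  ext
  simp only [Units.val_mul, val_awayUnit, ← map_mul, h]

theorem awayRes_awayUnit_div {a b f g : A} (ha : a ∣ f) (hb : b ∣ f) (hfg : f ∣ g) :
    awayRes hfg ↑(awayUnit ha / awayUnit hb) =
      ↑(awayUnit (ha.trans hfg) / awayUnit (hb.trans hfg)) := by
  have hmap {a : A} (ha : a ∣ f) :
      Units.map (awayRes hfg : Localization.Away f →* Localization.Away g) (awayUnit ha) =
        awayUnit (ha.trans hfg) :=
    Units.ext ((awayRes hfg).commutes a)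
  rw [← hmap ha, ← hmap hb, ← map_div]
  rfl

variable {B : Type v} [CommRing B] [Algebra A B]

/-- The twisted monogenerator with local monogenerators `x i` on `D(c i i)` and transition units
`c i j / c j j`, where the matrix `c` has rank one. -/
noncomputable def TwistedMonogenerator.ofRankOne {ι : Type u} (c : ι → ι → A) (x : ι → B)
    (hc : ∀ i j k l, c i j * c k l = c i l * c k j)
    (hspan : Ideal.span (Set.range fun i => c i i) = ⊤)
    (hcx : ∀ i j, c i j • x j = c j j • x i)
    (hx : ∀ i b, ∃ n, c i i ^ n • b ∈ Algebra.adjoin A {x i}) : TwistedMonogenerator A B ι where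
  f i := c i i
  cover := PrimeSpectrum.iSup_basicOpen_eq_top_iff.2 hspan
  θ i := 1 ⊗ₜ x i
  isMonogenerator i := isMonogenerator_one_tmul_iff.2 (hx i)
  a i j := awayUnit (Dvd.intro (c j i) (hc i j j i)) / awayUnit (dvd_mul_left (c j j) (c i i))
  smul_eq i j := by
    rw [awayAlgRes_one_tmul, awayAlgRes_one_tmul, ← Units.smul_def, div_eq_inv_mul, mul_smul,
      inv_smul_eq_iff, Units.smul_def, Units.smul_def, val_awayUnit, val_awayUnit, algebraMap_smul,
      algebraMap_smul, ← TensorProduct.tmul_smul, hcx, TensorProduct.tmul_smul]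
  cocycle i j k := by
    rw [awayRes_awayUnit_div, awayRes_awayUnit_div, awayRes_awayUnit_div, ← Units.val_mul,
      ← mul_div_assoc, div_mul_eq_mul_div, awayUnit_mul_awayUnit _ _ _
        ((dvd_mul_left _ _).mul_right _) (hc i j j k), mul_div_cancel_right]

section Invertible

variable {N : Type*} [AddCommGroup N] [Module A N] [Module.Invertible A N]

theorem dual_smul_comm (g : Module.Dual A N) (m n : N) : g m • n = g n • m := by
  simpa using congrArg (TensorProduct.lid A N ∘ g.rTensor N)
    (Module.Invertible.tmul_comm (R := A) (m₁ := m) (m₂ := n))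

theorem span_range_dual_eq_top :
    Ideal.span (Set.range fun p : Module.Dual A N × N => p.1 p.2) = ⊤ := by
  rw [Ideal.eq_top_iff_one]
  obtain ⟨z, hz⟩ := (Module.Invertible.linearEquiv A N).surjective 1
  rw [← hz]
  clear hz
  induction z using TensorProduct.induction_on with
  | zero => simp
  | add y z hy hz => rw [map_add]; exact add_mem hy hz
  | tmul g n => exact Ideal.subset_span ⟨(g, n), rfl⟩

end Invertible

-- On `D(g n)`, for `g` in the dual of `N`, the module `N` is free on `n`, so `φ n` generates `B`.
theorem isTwistedMonogenic_of_invertible {N : Type u} [AddCommGroup N] [Module A N]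
    [Module.Invertible A N] (φ : N →ₗ[A] B)
    (hφ : ∀ b, ∃ a n, b = algebraMap A B a + φ n) : IsTwistedMonogenic A B := by
  refine ⟨Module.Dual A N × N, ⟨.ofRankOne (fun i j => j.1 i.2) (fun i => φ i.2)
    (fun i j k l => ?_) span_range_dual_eq_top (fun i j => ?_) fun i b => ⟨1, ?_⟩⟩⟩
  · simpa [mul_comm] using congrArg l.1 (dual_smul_comm j.1 i.2 k.2)
  · rw [← map_smul, ← map_smul, dual_smul_comm]
  · obtain ⟨a, n, rfl⟩ := hφ b
    rw [pow_one, smul_add, ← map_smul φ, dual_smul_comm, map_smul φ]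
    exact add_mem (Subalgebra.smul_mem _ (Subalgebra.algebraMap_mem _ a) _)
      (Subalgebra.smul_mem _ (Algebra.self_mem_adjoin_singleton A _) _)

end RankOne

section Quadratic

theorem isIntegral_of_isIntegral_add_mul {R S : Type*} [CommRing R] [CommRing S] [Algebra R S]
    {x y : S} (hadd : IsIntegral R (x + y)) (hmul : IsIntegral R (x * y)) : IsIntegral R x := by
  let s : integralClosure R S := ⟨x + y, hadd⟩
  let p : integralClosure R S := ⟨x * y, hmul⟩
  have hx : IsIntegral (integralClosure R S) x := by
    refine ⟨Polynomial.X ^ 2 - Polynomial.C s * Polynomial.X + Polynomial.C p, by monicity!, ?_⟩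
    simp only [Polynomial.eval₂_add, Polynomial.eval₂_sub, Polynomial.eval₂_mul,
      Polynomial.eval₂_pow, Polynomial.eval₂_C, Polynomial.eval₂_X]
    change x ^ 2 - (x + y) * x + x * y = 0
    ring
  exact isIntegral_trans x hx

theorem exists_eq_algebraMap_add_smul_of_mem_adjoin {R S : Type*} [CommRing R] [CommRing S]
    [Algebra R S] {x : S} {t n : R} (hx : x ^ 2 = t • x - algebraMap R S n) {y : S}
    (hy : y ∈ Algebra.adjoin R {x}) : ∃ a b : R, y = algebraMap R S a + b • x := by
  induction hy using Algebra.adjoin_induction with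
  | mem y hy => exact ⟨0, 1, by simpa using hy⟩
  | algebraMap r => exact ⟨r, 0, by simp⟩
  | add y z _ _ hy hz =>
    obtain ⟨a, b, rfl⟩ := hy
    obtain ⟨a', b', rfl⟩ := hz
    exact ⟨a + a', b + b', by rw [map_add, add_smul]; ring⟩
  | mul y z _ _ hy hz =>
    obtain ⟨a, b, rfl⟩ := hy
    obtain ⟨a', b', rfl⟩ := hz
    refine ⟨a * a' - b * b' * n, a * b' + b * a' + b * b' * t, ?_⟩
    simp only [Algebra.smul_def, map_add, map_mul, map_sub] at hx ⊢
    linear_combination algebraMap R S b * algebraMap R S b' * hx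

/-- `K(√d)` for `d = 1 + 4e`, as the algebra `K[ω]` with `ω = (d + √d) / 2`, so that
`ω² = dω - de`. -/
abbrev AdjoinSqrt {A : Type*} (K : Type*) [CommRing A] [CommRing K] [Algebra A K] (d e : A) :
    Type _ :=
  QuadraticAlgebra K (-(algebraMap A K d * algebraMap A K e)) (algebraMap A K d)

section Integral

variable {A K : Type*} [CommRing A] [CommRing K] [Algebra A K]

theorem isIntegral_algebraMap_quadraticAlgebra_iff {a b s : K} :
    IsIntegral A (algebraMap K (QuadraticAlgebra K a b) s) ↔ IsIntegral A s :=
  isIntegral_algebraMap_iff QuadraticAlgebra.algebraMap_injective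

theorem isIntegral_quadraticAlgebra_iff {a b : K} {x : QuadraticAlgebra K a b} :
    IsIntegral A x ↔ IsIntegral A x.trace ∧ IsIntegral A x.norm := by
  rw [← isIntegral_algebraMap_quadraticAlgebra_iff (a := a) (b := b),
    ← isIntegral_algebraMap_quadraticAlgebra_iff (a := a) (b := b),
    QuadraticAlgebra.algebraMap_trace_eq_add_star, QuadraticAlgebra.algebraMap_norm_eq_mul_star]
  refine ⟨fun hx => ?_, fun h => isIntegral_of_isIntegral_add_mul h.1 h.2⟩
  have hstar : IsIntegral A (star x) :=
    hx.map_of_comp_eq (RingHom.id A) (starRingEnd _) <| by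
      ext r <;> simp [IsScalarTower.algebraMap_apply A K (QuadraticAlgebra K a b),
        starRingEnd_apply]
  exact ⟨hx.add hstar, hx.mul hstar⟩

theorem isIntegral_smul_omega {d e : A} {s : K} (hs : IsIntegral A (algebraMap A K d * s ^ 2)) :
    IsIntegral A (s • QuadraticAlgebra.omega : AdjoinSqrt K d e) := by
  have htrace : IsIntegral A (algebraMap A K d * s) := by
    refine IsIntegral.of_pow two_pos ?_
    rw [mul_pow, sq (algebraMap A K d), mul_assoc]
    exact isIntegral_algebraMap.mul hs
  have hnorm : IsIntegral A (algebraMap A K e * (algebraMap A K d * s ^ 2)) :=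
    isIntegral_algebraMap.mul hs
  refine isIntegral_quadraticAlgebra_iff.2 ⟨?_, ?_⟩
  · simpa [QuadraticAlgebra.trace_def, mul_comm] using htrace
  · convert hnorm using 1
    simp only [QuadraticAlgebra.norm_def, QuadraticAlgebra.re_smul, QuadraticAlgebra.im_smul,
      QuadraticAlgebra.omega_re, QuadraticAlgebra.omega_im, smul_eq_mul]
    ring

theorem isIntegral_adjoinSqrt_iff {d e : A} (hd : d - 1 = 4 * e) {x : AdjoinSqrt K d e} :
    IsIntegral A x ↔ IsIntegral A x.re ∧ IsIntegral A (algebraMap A K d * x.im ^ 2) := by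
  have hx : x = algebraMap K _ x.re + x.im • QuadraticAlgebra.omega := by ext <;> simp
  have hdisc : algebraMap A K d * x.im ^ 2 = x.trace ^ 2 - (4 : A) • x.norm := by
    have hd' : algebraMap A K d - 1 = 4 * algebraMap A K e := by
      simpa only [map_sub, map_mul, map_one, map_ofNat] using congrArg (algebraMap A K) hd
    rw [QuadraticAlgebra.trace_def, QuadraticAlgebra.norm_def, Algebra.smul_def, map_ofNat]
    linear_combination (-(algebraMap A K d * x.im ^ 2)) * hd'
  have him (h : IsIntegral A x) : IsIntegral A (algebraMap A K d * x.im ^ 2) := by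
    obtain ⟨htrace, hnorm⟩ := isIntegral_quadraticAlgebra_iff.1 h
    rw [hdisc]
    exact (htrace.pow 2).sub (hnorm.smul 4)
  refine ⟨fun h => ⟨?_, him h⟩, fun ⟨hre, him⟩ => ?_⟩
  · rw [← isIntegral_algebraMap_quadraticAlgebra_iff, eq_sub_of_add_eq hx.symm]
    exact h.sub (isIntegral_smul_omega (him h))
  · rw [hx]
    exact hre.algebraMap.add (isIntegral_smul_omega him)

end Integral

section FractionField

variable {A K : Type*} [CommRing A] [Field K] [Algebra A K] [IsFractionRing A K]

theorem exists_smul_im_eq_of_mem_adjoin [IsDomain A] [IsIntegrallyClosed A] {a b : K}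
    {x y : QuadraticAlgebra K a b} (hx : IsIntegral A x) (hy : y ∈ Algebra.adjoin A {x}) :
    ∃ r : A, r • x.im = y.im := by
  obtain ⟨htrace, hnorm⟩ := isIntegral_quadraticAlgebra_iff.1 hx
  obtain ⟨t, ht⟩ := IsIntegrallyClosed.algebraMap_eq_of_integral htrace
  obtain ⟨n, hn⟩ := IsIntegrallyClosed.algebraMap_eq_of_integral hnorm
  have hsq : x ^ 2 = t • x - algebraMap A _ n := by
    rw [QuadraticAlgebra.sq_eq_trace_smul_sub_norm, ← ht, ← hn, algebraMap_smul,
      ← IsScalarTower.algebraMap_apply]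
  obtain ⟨r, s, rfl⟩ := exists_eq_algebraMap_add_smul_of_mem_adjoin hsq hy
  exact ⟨s, by simp [IsScalarTower.algebraMap_apply A K (QuadraticAlgebra K a b)]⟩

variable [IsDedekindDomain A] {d : A} {J : Ideal A}

open FractionalIdeal nonZeroDivisors

theorem IsSquarePart.isPrincipal_of_sq {t : A} (h : IsSquarePart (t ^ 2) J) : J.IsPrincipal := by
  obtain ⟨S, hS, h⟩ := h
  rw [← Ideal.span_singleton_pow] at h
  have hJt : J ∣ Ideal.span {t} :=
    (UniqueFactorizationMonoid.pow_dvd_pow_iff_dvd two_ne_zero).1 (Dvd.intro S h.symm)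
  have htJ : Ideal.span {t} ∣ J := dvd_of_sq_dvd_sq_mul_squarefree hS h.dvd
  exact ⟨t, dvd_antisymm hJt htJ⟩

theorem IsSquarePart.mem_inv_iff (h : IsSquarePart d J) (hJ : J ≠ ⊥) {s : K} :
    s ∈ (J : FractionalIdeal A⁰ K)⁻¹ ↔ IsIntegral A (algebraMap A K d * s ^ 2) := by
  obtain ⟨S, hS, h⟩ := h
  obtain ⟨α, β, hβ, rfl⟩ := IsFractionRing.div_surjective (A := A) s
  have hβ' : algebraMap A K β ≠ 0 := by simpa using nonZeroDivisors.ne_zero hβ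
  have hinv : algebraMap A K α / algebraMap A K β ∈ (J : FractionalIdeal A⁰ K)⁻¹ ↔
      Ideal.span {β} ∣ Ideal.span {α} * J := by
    rw [FractionalIdeal.mem_inv_iff (coeIdeal_ne_zero.2 hJ), Ideal.dvd_iff_le,
      Ideal.span_singleton_mul_le_iff]
    simp only [mem_coeIdeal, forall_exists_index, and_imp, forall_apply_eq_imp_iff₂,
      Ideal.mem_span_singleton, mem_one_iff]
    refine forall₂_congr fun j _ => exists_congr fun r => ?_
    rw [div_mul_eq_mul_div, eq_div_iff hβ', ← map_mul, ← map_mul,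
      (IsFractionRing.injective A K).eq_iff, mul_comm r, eq_comm]
  have hint : IsIntegral A (algebraMap A K d * (algebraMap A K α / algebraMap A K β) ^ 2) ↔
      Ideal.span {β} ^ 2 ∣ (Ideal.span {α} * J) ^ 2 * S := by
    rw [mul_pow, mul_assoc, ← h, Ideal.span_singleton_pow, Ideal.span_singleton_pow,
      Ideal.span_singleton_mul_span_singleton, Ideal.dvd_span_singleton, Ideal.mem_span_singleton,
      IsIntegrallyClosed.isIntegral_iff]
    refine exists_congr fun r => ?_
    rw [div_pow, mul_div_assoc', eq_div_iff (pow_ne_zero 2 hβ'), ← map_pow, ← map_pow, ← map_mul,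
      ← map_mul, (IsFractionRing.injective A K).eq_iff, mul_comm r, mul_comm d, eq_comm]
  rw [hinv, hint]
  exact ⟨fun h => (pow_dvd_pow_of_dvd h 2).mul_right S, dvd_of_sq_dvd_sq_mul_squarefree hS⟩

theorem isPrincipal_of_inv_eq_spanSingleton {s : K}
    (h : (J : FractionalIdeal A⁰ K)⁻¹ = spanSingleton A⁰ s) : J.IsPrincipal := by
  have hJ : ((J : FractionalIdeal A⁰ K) : Submodule A K).IsPrincipal := by
    rw [isPrincipal_iff]
    exact ⟨s⁻¹, by rw [← spanSingleton_inv, ← h, inv_inv]⟩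
  rwa [coe_coeIdeal, IsFractionRing.coeSubmodule_isPrincipal] at hJ

theorem invertible_coeSubmodule {I : FractionalIdeal A⁰ K} (hI : I ≠ 0) :
    Module.Invertible A (I : Submodule A K) :=
  inferInstanceAs (Module.Invertible A (unitsMulEquivSubmodule (Units.mk0 I hI)))

variable {e : A}

theorem IsSquarePart.isPrincipal_of_root (h : IsSquarePart d J) (hd : d - 1 = 4 * e) {r : K}
    (hr : r ^ 2 = -(algebraMap A K d * algebraMap A K e) + algebraMap A K d * r) :
    J.IsPrincipal := by
  have hs : (2 * r - algebraMap A K d) ^ 2 = algebraMap A K d := by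
    have hd' : algebraMap A K d - 1 = 4 * algebraMap A K e := by
      simpa only [map_sub, map_mul, map_one, map_ofNat] using congrArg (algebraMap A K) hd
    linear_combination 4 * hr + algebraMap A K d * hd'
  obtain ⟨t, ht⟩ := IsIntegrallyClosed.algebraMap_eq_of_integral
    (IsIntegral.of_pow two_pos (hs ▸ isIntegral_algebraMap))
  rw [← ht, ← map_pow] at hs
  exact (IsFractionRing.injective A K hs ▸ h).isPrincipal_of_sq

theorem IsSquarePart.isPrincipal_of_isMonogenic (h : IsSquarePart d J) (hJ : J ≠ ⊥)
    (hd : d - 1 = 4 * e) (hB : IsMonogenic A (integralClosure A (AdjoinSqrt K d e))) :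
    J.IsPrincipal := by
  obtain ⟨⟨x, hx⟩, hB⟩ := hB
  refine isPrincipal_of_inv_eq_spanSingleton (s := x.im) (le_antisymm (fun s hs => ?_) ?_)
  · have hsx : s • QuadraticAlgebra.omega ∈ Algebra.adjoin A {x} := by
      have hval := AlgHom.map_adjoin_singleton (integralClosure A (AdjoinSqrt K d e)).val ⟨x, hx⟩
      rw [← show _ = Algebra.adjoin A {x} from hval]
      exact ⟨⟨_, isIntegral_smul_omega ((h.mem_inv_iff hJ).1 hs)⟩, hB ▸ Algebra.mem_top, rfl⟩
    obtain ⟨r, hr⟩ := exists_smul_im_eq_of_mem_adjoin hx hsx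
    exact (mem_spanSingleton _).2 ⟨r, by simpa using hr⟩
  · exact spanSingleton_le_iff_mem.2 ((h.mem_inv_iff hJ).2 ((isIntegral_adjoinSqrt_iff hd).1 hx).2)

end FractionField

end Quadratic

section TwistedMonogenic

variable {A K : Type u} [CommRing A] [Field K] [Algebra A K] [IsFractionRing A K]

theorem isTwistedMonogenic_adjoinSqrt [IsDomain A] [IsIntegrallyClosed A] {d e : A}
    (hd : d - 1 = 4 * e) {N : Submodule A K} [Module.Invertible A N]
    (hN : ∀ s, s ∈ N ↔ IsIntegral A (algebraMap A K d * s ^ 2)) :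
    IsTwistedMonogenic A (integralClosure A (AdjoinSqrt K d e)) := by
  let φ : N →ₗ[A] integralClosure A (AdjoinSqrt K d e) :=
    ((LinearMap.toSpanSingleton K (AdjoinSqrt K d e) QuadraticAlgebra.omega).restrictScalars A ∘ₗ
      N.subtype).codRestrict (Subalgebra.toSubmodule (integralClosure A _)) fun s =>
        isIntegral_smul_omega ((hN s).1 s.2)
  refine isTwistedMonogenic_of_invertible φ fun ⟨x, hx⟩ => ?_
  obtain ⟨hre, him⟩ := (isIntegral_adjoinSqrt_iff hd).1 hx
  obtain ⟨a, ha⟩ := IsIntegrallyClosed.algebraMap_eq_of_integral hre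
  refine ⟨a, ⟨x.im, (hN _).2 him⟩, Subtype.ext ?_⟩
  change x = algebraMap A _ a + x.im • QuadraticAlgebra.omega
  ext <;> simp [IsScalarTower.algebraMap_apply A K (AdjoinSqrt K d e), ha]

open FractionalIdeal nonZeroDivisors in
theorem IsSquarePart.isTwistedMonogenic [IsDedekindDomain A] {d e : A} {J : Ideal A}
    (h : IsSquarePart d J) (hJ : J ≠ ⊥) (hd : d - 1 = 4 * e) :
    IsTwistedMonogenic A (integralClosure A (AdjoinSqrt K d e)) := by
  have := invertible_coeSubmodule (inv_ne_zero (coeIdeal_ne_zero (K := K).2 hJ))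
  exact isTwistedMonogenic_adjoinSqrt hd fun s => h.mem_inv_iff hJ (s := s)

end TwistedMonogenic

section Surjective

variable {A : Type u} [CommRing A] {B : Type v} [CommRing B] [Algebra A B] {C : Type*}
  [CommRing C] [Algebra A C] {φ : B →ₐ[A] C}

theorem IsMonogenerator.map {θ : B} (h : IsMonogenerator A θ) (hφ : Function.Surjective φ) :
    IsMonogenerator A (φ θ) := by
  rw [IsMonogenerator, ← AlgHom.map_adjoin_singleton, h, Algebra.map_top]
  exact AlgHom.range_eq_top φ |>.2 hφ

theorem IsMonogenic.of_surjective (h : IsMonogenic A B) (hφ : Function.Surjective φ) :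
    IsMonogenic A C :=
  h.imp' φ fun _ hθ => hθ.map hφ

variable (φ) in
/-- The map `B[1/f] → C[1/f]` induced by `φ : B → C`. -/
noncomputable def awayAlgMap (f : A) : AwayAlg B f →ₐ[Localization.Away f] AwayAlg C f :=
  Algebra.TensorProduct.map (AlgHom.id _ _) φ

theorem awayAlgMap_tmul {f : A} (r : Localization.Away f) (b : B) :
    awayAlgMap φ f (r ⊗ₜ b) = r ⊗ₜ φ b :=
  Algebra.TensorProduct.map_tmul _ _ r b

theorem awayAlgMap_surjective (hφ : Function.Surjective φ) (f : A) :
    Function.Surjective (awayAlgMap φ f) :=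
  LinearMap.lTensor_surjective (Localization.Away f) (g := φ.toLinearMap) hφ

theorem awayAlgMap_awayAlgRes {f g : A} (h : f ∣ g) (y : AwayAlg B f) :
    awayAlgMap φ g (awayAlgRes B h y) = awayAlgRes C h (awayAlgMap φ f y) := by
  induction y using TensorProduct.induction_on with
  | zero => simp only [map_zero]
  | add y z hy hz => simp only [map_add, hy, hz]
  | tmul r b => simp [awayAlgRes, awayAlgMap_tmul]

variable (φ) in
/-- The image of a twisted monogenerator under a surjection. -/
noncomputable def TwistedMonogenerator.map {ι : Type u} (T : TwistedMonogenerator A B ι)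
    (hφ : Function.Surjective φ) : TwistedMonogenerator A C ι where
  f := T.f
  cover := T.cover
  θ i := awayAlgMap φ (T.f i) (T.θ i)
  isMonogenerator i := (T.isMonogenerator i).map (awayAlgMap_surjective hφ _)
  a := T.a
  smul_eq i j := by
    rw [← awayAlgMap_awayAlgRes, ← awayAlgMap_awayAlgRes, ← T.smul_eq]
    exact (map_smul (awayAlgMap φ (T.f i * T.f j)) _ _).symm
  cocycle := T.cocycle

theorem IsTwistedMonogenic.of_surjective (h : IsTwistedMonogenic A B)
    (hφ : Function.Surjective φ) : IsTwistedMonogenic A C :=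
  h.imp fun _ ⟨T⟩ => ⟨T.map φ hφ⟩

theorem isMonogenic_congr (e : B ≃ₐ[A] C) : IsMonogenic A B ↔ IsMonogenic A C :=
  ⟨fun h => h.of_surjective (φ := e.toAlgHom) e.surjective,
    fun h => h.of_surjective (φ := e.symm.toAlgHom) e.symm.surjective⟩

theorem isTwistedMonogenic_congr (e : B ≃ₐ[A] C) :
    IsTwistedMonogenic A B ↔ IsTwistedMonogenic A C :=
  ⟨fun h => h.of_surjective (φ := e.toAlgHom) e.surjective,
    fun h => h.of_surjective (φ := e.symm.toAlgHom) e.symm.surjective⟩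

end Surjective

theorem mainTheorem7_general {A K : Type u} [CommRing A] [IsDedekindDomain A] [Field K]
    [Algebra A K] [IsFractionRing A K] (h2 : (2 : A) ≠ 0) :
    IsPrincipalIdealRing A ↔
      ∀ (L : Type u) [Field L] [Algebra K L] [FiniteDimensional K L] [Algebra A L]
        [IsScalarTower A K L],
        IsTwistedMonogenic A (integralClosure A L) → IsMonogenic A (integralClosure A L) := by
  refine ⟨fun _ _ _ _ _ _ _ h => h.isMonogenic, fun H => ?_⟩
  have h4 : Ideal.span {(4 : A)} ≠ ⊥ := by
    rw [Ne, Ideal.span_singleton_eq_bot, show (4 : A) = 2 * 2 by norm_num]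
    exact mul_ne_zero h2 h2
  refine isPrincipalIdealRing_of_forall_isSquarePart h4 fun d J hd hJ => ?_
  obtain ⟨e, he⟩ := Ideal.mem_span_singleton.1 hd
  by_contra hprin
  have hJ0 : J ≠ ⊥ := fun h => hprin (h ▸ inferInstance)
  have : Fact (∀ r : K, r ^ 2 ≠ -(algebraMap A K d * algebraMap A K e) + algebraMap A K d * r) :=
    ⟨fun r hr => hprin (hJ.isPrincipal_of_root he hr)⟩
  exact hprin (hJ.isPrincipal_of_isMonogenic hJ0 he
    (H (AdjoinSqrt K d e) (hJ.isTwistedMonogenic hJ0 he)))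

section RingOfIntegers

variable {K L : Type*} [Field K] [Field L] [Algebra K L] [Algebra (𝓞 K) L]
  [IsScalarTower (𝓞 K) K L]

theorem nonempty_algEquiv_ringOfIntegers :
    Nonempty (integralClosure (𝓞 K) L ≃ₐ[𝓞 K] 𝓞 L) := by
  have : IsScalarTower (𝓞 K) (𝓞 L) L := .of_algebraMap_eq fun x => by
    rw [IsScalarTower.algebraMap_apply (𝓞 K) K L]
    rfl
  have : IsIntegralClosure (𝓞 L) (𝓞 K) L := IsIntegralClosure.tower_top (R := ℤ)
  exact ⟨IsIntegralClosure.equiv (𝓞 K) _ L (𝓞 L)⟩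

end RingOfIntegers

theorem mainTheorem7 (K : Type u) [Field K] [NumberField K] :
    NumberField.classNumber K = 1 ↔
      ∀ (L : Type u) [Field L] [NumberField L] [Algebra K L],
        IsTwistedMonogenic (𝓞 K) (𝓞 L) → IsMonogenic (𝓞 K) (𝓞 L) := by
  rw [NumberField.classNumber_eq_one_iff, mainTheorem7_general (K := K) two_ne_zero]
  refine ⟨fun H L _ _ _ => ?_, fun H L _ _ _ _ _ => ?_⟩
  · obtain ⟨e⟩ := nonempty_algEquiv_ringOfIntegers (K := K) (L := L)
    exact (imp_congr (isTwistedMonogenic_congr e) (isMonogenic_congr e)).1 (H L)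
  · have := NumberField.of_module_finite K L
    obtain ⟨e⟩ := nonempty_algEquiv_ringOfIntegers (K := K) (L := L)
    exact (imp_congr (isTwistedMonogenic_congr e) (isMonogenic_congr e)).2 (H L)
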